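/- Let $U$ be a set of $n\ge 1$ items with weights $w:U\to[0,\infty)$ and total weight $W=\sum_{a\in U}w(a)>0$. In the hybrid setting, an algorithm accesses $(U,w)$ only through independent samples: at each step it may choose, adaptively and using internal randomness, to take either a proportional sample (item $a$ with probability $w(a)/W$) or a uniform sample (each item with probability $1/n$). It learns the weight of every sampled item and, for any two samples, whether they are the same item, and nothing else about $(U,w)$. It may decide at run-time when to stop and return an estimate $\hat W$. The numbers $n$ and $\varepsilon$ are known to the algorithm. Theorem. For every $\varepsilon_0<1$ there is a constant $c>0$, depending only on $\varepsilon_0$, such that the following holds for all integers $n\ge 1$ and all $0<\varepsilon\le\varepsilon_0$. If an algorithm in the hybrid setting returns, for every instance $(U,w)$ with $|U|=n$ and $W>0$, with probability at least $2/3$ an estimate $\hat W$ with $(1-\varepsilon)W\le\hat W\le(1+\varepsilon)W$, then there is an instance $(U,w)$ with $|U|=n$ and $W>0$ on which the expected total number of (proportional and uniform) samples that it takes is at least $$c\cdot\min\left(\frac{n^{1/3}}{\varepsilon^{4/3}},\,n\right).$$ In particular, its worst-case number of samples is at least this large. -/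

import Mathlib

open MeasureTheory
open scoped ENNReal NNReal

/-- An instance of the sum estimation problem with exactly `n` items: a weight function
`w : U → [0, ∞)` on a set `U` of `n` items (here `U = Fin n`; algorithms never see the names of the
items). The total weight is positive, so that proportional sampling makes sense. -/
structure SumInstance (n : ℕ) where
  w : Fin n → ℝ≥0
  sum_pos : 0 < ∑ a, w a

namespace SumInstance

variable {n : ℕ}

/-- The total weight `W`. -/
def total (I : SumInstance n) : ℝ := ∑ a, (I.w a : ℝ)

theorem nonempty_items (I : SumInstance n) : Nonempty (Fin n) := by
  by_contra h
  rw [not_nonempty_iff] at h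
  have h0 := I.sum_pos
  simp at h0

theorem tsum_ne_zero (I : SumInstance n) : ∑' a, (I.w a : ℝ≥0∞) ≠ 0 := by
  rw [tsum_fintype]
  exact_mod_cast I.sum_pos.ne'

theorem tsum_ne_top (I : SumInstance n) : ∑' a, (I.w a : ℝ≥0∞) ≠ ∞ := by
  rw [tsum_fintype]
  exact_mod_cast ENNReal.coe_ne_top (r := ∑ a, I.w a)

/-- The law of a proportional sample: item `a` has probability `w a / W`. -/
noncomputable def proportional (I : SumInstance n) : PMF (Fin n) :=
  PMF.normalize (fun a => (I.w a : ℝ≥0∞)) I.tsum_ne_zero I.tsum_ne_top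

/-- The law of a uniform sample: every item has probability `1 / n`. -/
noncomputable def uniform (I : SumInstance n) : PMF (Fin n) :=
  haveI := I.nonempty_items
  PMF.uniformOfFintype (Fin n)

/-- An infinite supply of independent samples: for every `t : ℕ`, the first component of `x t` is a
proportional sample, its second component is a uniform sample, and all of them are independent. -/
noncomputable def supply (I : SumInstance n) : Measure (ℕ → Fin n × Fin n) :=
  Measure.infinitePi fun _ => I.proportional.toMeasure.prod I.uniform.toMeasure

/-- All that can be learnt about a sequence `s` of `t` sampled items: the weight of each of them,
and, for any two of them, whether they are the same item. -/
def view (I : SumInstance n) {t : ℕ} (s : Fin t → Fin n) : (Fin t → ℝ) × (Fin t → Fin t → Bool) :=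
  (fun i => (I.w (s i) : ℝ), fun i j => decide (s i = s j))

end SumInstance

/-- The two kinds of samples of the hybrid setting. -/
inductive SampleKind
  | proportional
  | uniform

instance : MeasurableSpace SampleKind := ⊤

/-- An adaptive randomized algorithm in the hybrid setting, with internal randomness in `Ω`. After
`t` samples it decides, from its randomness and from the weights and the equality pattern of the
`t` sampled items, either to take one more sample of a kind of its choice (`Sum.inl`), or to stop
and to return an estimate (`Sum.inr`). -/
structure HybridAlgorithm (Ω : Type*) [MeasurableSpace Ω] where
  step : (t : ℕ) → Ω × (Fin t → ℝ) × (Fin t → Fin t → Bool) → SampleKind ⊕ ℝ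
  measurable_step : ∀ t, Measurable (step t)

namespace HybridAlgorithm

variable {Ω : Type*} [MeasurableSpace Ω] (A : HybridAlgorithm Ω) {n : ℕ} (I : SumInstance n)

/-- The first `t` items sampled when the algorithm runs on `I` with internal randomness `r` and
supply of samples `x`: the sample number `t` is one of the two components of `x t`. (The value after
the algorithm has stopped is irrelevant.) -/
def sampled (r : Ω) (x : ℕ → Fin n × Fin n) : (t : ℕ) → Fin t → Fin n
  | 0 => Fin.elim0
  | t + 1 =>
    Fin.snoc (α := fun _ => Fin n) (sampled r x t)
      (match A.step t (r, I.view (sampled r x t)) with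
        | Sum.inl SampleKind.proportional => (x t).1
        | Sum.inl SampleKind.uniform => (x t).2
        | Sum.inr _ => (x t).2)

/-- What the algorithm does after `t` samples. -/
def action (r : Ω) (x : ℕ → Fin n × Fin n) (t : ℕ) : SampleKind ⊕ ℝ :=
  A.step t (r, I.view (A.sampled I r x t))

/-- The run takes exactly `t` samples, then stops and returns `y`. -/
def Returns (r : Ω) (x : ℕ → Fin n × Fin n) (t : ℕ) (y : ℝ) : Prop :=
  (∀ s < t, (A.action I r x s).isLeft) ∧ A.action I r x t = Sum.inr y

/-- The number of samples that the run takes in total: the first time at which the algorithm stops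
(`∞` if it never stops). -/
noncomputable def numSamples (r : Ω) (x : ℕ → Fin n × Fin n) : ℝ≥0∞ :=
  ⨅ (t : ℕ) (_ : (A.action I r x t).isRight), (t : ℝ≥0∞)

/-- The expected number of samples on the instance `I`, when the internal randomness has law `P`. -/
noncomputable def expectedSamples (P : Measure Ω) : ℝ≥0∞ :=
  ∫⁻ z, A.numSamples I z.1 z.2 ∂(P.prod I.supply)

/-- The probability that, on the instance `I`, the algorithm stops and returns a
`(1 ± ε)`-approximation of the total weight. -/
noncomputable def successProb (P : Measure Ω) (ε : ℝ) : ℝ≥0∞ :=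
  (P.prod I.supply) {z | ∃ (t : ℕ) (y : ℝ), A.Returns I z.1 z.2 t y ∧
    (1 - ε) * I.total ≤ y ∧ y ≤ (1 + ε) * I.total}

end HybridAlgorithm

/-! Two instances with weights in `{0, 1}` are compared, one with `s` ones and one with `s + d`,
where `d` is of order `ε * s`, so that no estimate is good for both. Proportional samples return
only ones and carry information only through collisions, worth about `m ^ 2 * ε ^ 2 / s` over `m`
samples. Uniform samples also reveal the frequency of ones, worth about `m * ε ^ 2 * s / n`. With
`s` of order `(n / ε) ^ (2 / 3)`, both stay small until `m` is of order `n ^ (1 / 3) / ε ^ (4 / 3)`.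

Information is measured by the second moment of the likelihood ratio of the views, used only through
its dual Cauchy-Schwarz form `SecondMomentLE`, so no law on views has to be constructed. This form
passes through adaptivity: equal views force the same next kind of sample, so it suffices to bound
one step (`SumInstance.sum_prob_zeroOne_sq_le`) by a factor `1 + δ` and to induct
(`secondMomentLE_zeroOne`). In one step, already seen items correspond one to one and only the
numbers of unseen items differ (`sum_filter_sq_le`); the terms linear in `d` cancel, so `δ` is
quadratic in `d`.

A second moment close to `1` nearly preserves the probabilities of outputs (`measure_section_le`),
while Markov's inequality replaces the run by its first `m` samples. If `ε` is below the order of `n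
^ (-1 / 2)`, the accuracy is relaxed to that order, where the bound is already linear in `n`. -/

/-! ### Measurability of runs -/

/-- The kind of the next sample, with uniform samples as the default after stopping. -/
def SampleKind.ofStep : SampleKind ⊕ ℝ → SampleKind
  | Sum.inl SampleKind.proportional => SampleKind.proportional
  | Sum.inl SampleKind.uniform => SampleKind.uniform
  | Sum.inr _ => SampleKind.uniform

/-- The component of a pair of samples that has the given kind. -/
def SampleKind.select {α : Type*} : SampleKind → α × α → α
  | SampleKind.proportional => Prod.fst
  | SampleKind.uniform => Prod.snd

instance : DiscreteMeasurableSpace SampleKind := ⟨fun _ => trivial⟩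

instance : Finite SampleKind :=
  Finite.of_injective (fun k : SampleKind => (match k with | .proportional => true | .uniform => false))
    (by intro a b h; cases a <;> cases b <;> simp_all)

theorem SampleKind.measurable_ofStep : Measurable SampleKind.ofStep := by
  refine measurable_fun_sum (Measurable.of_discrete) ?_
  exact (measurable_const : Measurable fun _ : ℝ => SampleKind.uniform)

/-! ### Laws of a single sample -/

namespace SumInstance

variable {n : ℕ} (I : SumInstance n)

/-- The probability that a sample of the given kind is the given item. -/
noncomputable def prob (k : SampleKind) (a : Fin n) : ℝ :=
  match k with
  | SampleKind.proportional => (I.proportional a).toReal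
  | SampleKind.uniform => (I.uniform a).toReal

theorem prob_nonneg (k : SampleKind) (a : Fin n) : 0 ≤ I.prob k a := by
  cases k <;> exact ENNReal.toReal_nonneg

theorem measure_select_eq (k : SampleKind) (a : Fin n) :
    ((I.proportional.toMeasure.prod I.uniform.toMeasure) {z | k.select z = a}).toReal =
      I.prob k a := by
  cases k
  · have : {z : Fin n × Fin n | SampleKind.proportional.select z = a} = {a} ×ˢ Set.univ := by
      ext z; simp [SampleKind.select]
    rw [this, Measure.prod_prod, PMF.toMeasure_apply_singleton _ _ (measurableSet_singleton a)]
    simp [prob]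
  · have : {z : Fin n × Fin n | SampleKind.uniform.select z = a} = Set.univ ×ˢ {a} := by
      ext z; simp [SampleKind.select]
    rw [this, Measure.prod_prod, PMF.toMeasure_apply_singleton _ _ (measurableSet_singleton a)]
    simp [prob]

theorem prob_uniform (a : Fin n) : I.prob SampleKind.uniform a = 1 / n := by
  simp [prob, uniform, PMF.uniformOfFintype_apply]

theorem prob_proportional (a : Fin n) :
    I.prob SampleKind.proportional a = I.w a / I.total := by
  simp only [prob, proportional, PMF.normalize_apply, total, tsum_fintype, ENNReal.toReal_mul,
    ENNReal.toReal_inv, div_eq_mul_inv]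
  congr 2
  rw [ENNReal.toReal_sum (fun _ _ => ENNReal.coe_ne_top)]
  simp

instance : IsProbabilityMeasure I.supply := by
  unfold supply; infer_instance

end SumInstance

namespace HybridAlgorithm

variable {Ω : Type*} [MeasurableSpace Ω] (A : HybridAlgorithm Ω) {n : ℕ} (I : SumInstance n)

/-- The kind of the sample taken after the items `X` have been sampled. -/
def nextKind (r : Ω) {t : ℕ} (X : Fin t → Fin n) : SampleKind :=
  SampleKind.ofStep (A.step t (r, I.view X))

theorem sampled_succ (r : Ω) (x : ℕ → Fin n × Fin n) (t : ℕ) :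
    A.sampled I r x (t + 1) = Fin.snoc (α := fun _ => Fin n) (A.sampled I r x t)
      ((A.nextKind I r (A.sampled I r x t)).select (x t)) := by
  rw [sampled, nextKind]
  congr 1
  rcases A.step t (r, I.view (A.sampled I r x t)) with (_ | _) | _ <;> rfl

theorem sampled_castLE (r : Ω) (x : ℕ → Fin n × Fin n) {s t : ℕ} (h : s ≤ t) :
    (fun i => A.sampled I r x t (Fin.castLE h i)) = A.sampled I r x s := by
  induction t, h using Nat.le_induction with
  | base => rfl
  | succ t h ih =>
    rw [← ih]
    funext i
    rw [sampled_succ]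
    exact Fin.snoc_castSucc (α := fun _ => Fin n) _ _ (Fin.castLE h i)

theorem measurable_sampled (t : ℕ) :
    Measurable fun z : Ω × (ℕ → Fin n × Fin n) => A.sampled I z.1 z.2 t := by
  induction t with
  | zero => exact measurable_const
  | succ t ih =>
    have hv : Measurable fun z : Ω × (ℕ → Fin n × Fin n) => I.view (A.sampled I z.1 z.2 t) :=
      (Measurable.of_discrete (f := fun X : Fin t → Fin n => I.view X)).comp ih
    have hk : Measurable fun z : Ω × (ℕ → Fin n × Fin n) =>
        A.nextKind I z.1 (A.sampled I z.1 z.2 t) :=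
      SampleKind.measurable_ofStep.comp ((A.measurable_step t).comp (measurable_fst.prodMk hv))
    have hx : Measurable fun z : Ω × (ℕ → Fin n × Fin n) => z.2 t :=
      (measurable_pi_apply t).comp measurable_snd
    have hs : Measurable fun q : (Fin t → Fin n) × SampleKind × (Fin n × Fin n) =>
        (Fin.snoc (α := fun _ => Fin n) q.1 (q.2.1.select q.2.2) : Fin (t + 1) → Fin n) :=
      Measurable.of_discrete
    simp only [sampled_succ]
    exact hs.comp (ih.prodMk (hk.prodMk hx))

theorem measurable_action (t : ℕ) :
    Measurable fun z : Ω × (ℕ → Fin n × Fin n) => A.action I z.1 z.2 t :=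
  (A.measurable_step t).comp (measurable_fst.prodMk
    ((Measurable.of_discrete (f := fun X : Fin t → Fin n => I.view X)).comp
      (A.measurable_sampled I t)))

theorem measurableSet_isLeft : MeasurableSet {y : SampleKind ⊕ ℝ | y.isLeft} := by
  have : {y : SampleKind ⊕ ℝ | y.isLeft} = Set.range Sum.inl := by
    ext y; cases y <;> simp
  rw [this]
  exact measurableSet_range_inl

/-! ### Events decided by the first `m` samples -/

/-- The runs that return an element of `J` after at most `m` samples. -/
def returnsWithin (m : ℕ) (J : Set ℝ) : Set (Ω × (ℕ → Fin n × Fin n)) :=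
  {z | ∃ t ≤ m, ∃ y ∈ J, A.Returns I z.1 z.2 t y}

/-- The runs that take more than `m` samples. -/
def runsBeyond (m : ℕ) : Set (Ω × (ℕ → Fin n × Fin n)) :=
  {z | ∀ t ≤ m, (A.action I z.1 z.2 t).isLeft}

theorem measurableSet_runsBeyond (m : ℕ) : MeasurableSet (A.runsBeyond I m) := by
  have : A.runsBeyond I m = ⋂ t ∈ Set.Iic m,
      (fun z : Ω × (ℕ → Fin n × Fin n) => A.action I z.1 z.2 t) ⁻¹' {y | y.isLeft} := by
    ext z; simp [runsBeyond]
  rw [this]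
  exact MeasurableSet.biInter (Set.to_countable _)
    fun t _ => A.measurable_action I t measurableSet_isLeft

theorem measurableSet_returnsWithin (m : ℕ) {J : Set ℝ} (hJ : MeasurableSet J) :
    MeasurableSet (A.returnsWithin I m J) := by
  have : A.returnsWithin I m J = ⋃ t ∈ Set.Iic m,
      ((⋂ s ∈ Set.Iio t,
        (fun z : Ω × (ℕ → Fin n × Fin n) => A.action I z.1 z.2 s) ⁻¹' {y | y.isLeft}) ∩
      (fun z : Ω × (ℕ → Fin n × Fin n) => A.action I z.1 z.2 t) ⁻¹' (Sum.inr '' J)) := by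
    ext z
    simp only [returnsWithin, Returns, Set.mem_ofPred_eq, Set.mem_iUnion, Set.mem_inter_iff,
      Set.mem_iInter, Set.mem_preimage, Set.mem_image, Set.mem_Iic, Set.mem_Iio, exists_prop]
    constructor
    · rintro ⟨t, ht, y, hy, h1, h2⟩
      exact ⟨t, ht, h1, y, hy, h2.symm⟩
    · rintro ⟨t, ht, h1, y, hy, h2⟩
      exact ⟨t, ht, y, hy, h1, h2.symm⟩
  rw [this]
  refine MeasurableSet.biUnion (Set.to_countable _) fun t _ => MeasurableSet.inter ?_ ?_
  · exact MeasurableSet.biInter (Set.to_countable _)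
      fun t _ => A.measurable_action I t measurableSet_isLeft
  · exact A.measurable_action I t hJ.inr_image

theorem disjoint_returnsWithin (m : ℕ) {J K : Set ℝ} (h : Disjoint J K) :
    Disjoint (A.returnsWithin I m J) (A.returnsWithin I m K) := by
  rw [Set.disjoint_left]
  rintro z ⟨t, -, y, hy, h1, h2⟩ ⟨t', -, y', hy', h1', h2'⟩
  obtain rfl : t = t' := by
    rcases lt_trichotomy t t' with hlt | heq | hlt
    · have := h1' t hlt
      rw [h2] at this
      simp at this
    · exact heq
    · have := h1 t' hlt
      rw [h2'] at this
      simp at this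
  rw [h2] at h2'
  obtain rfl : y = y' := by simpa using h2'
  exact Set.disjoint_left.1 h hy hy'

/-- Markov's inequality: a run still going after `m` samples takes at least `m + 1`. -/
theorem mul_measure_runsBeyond_le (P : Measure Ω) (m : ℕ) :
    ((m : ℝ≥0∞) + 1) * (P.prod I.supply) (A.runsBeyond I m) ≤ A.expectedSamples I P := by
  rw [← lintegral_indicator_const (A.measurableSet_runsBeyond I m), expectedSamples]
  refine lintegral_mono fun z => ?_
  by_cases hz : z ∈ A.runsBeyond I m
  · rw [Set.indicator_of_mem hz]
    refine le_iInf₂ fun t ht => ?_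
    have : m < t := by
      by_contra! hle
      have h1 := hz t hle
      rcases h : A.action I z.1 z.2 t <;> simp_all
    exact_mod_cast this
  · rw [Set.indicator_of_notMem hz]
    exact zero_le

theorem successProb_le (P : Measure Ω) (ε : ℝ) (m : ℕ) :
    A.successProb I P ε ≤
      (P.prod I.supply) (A.returnsWithin I m (Set.Icc ((1 - ε) * I.total) ((1 + ε) * I.total))) +
        (P.prod I.supply) (A.runsBeyond I m) := by
  refine (measure_mono ?_).trans (measure_union_le _ _)
  rintro z ⟨t, y, hret, h1, h2⟩
  by_cases ht : t ≤ m
  · exact Or.inl ⟨t, ht, y, ⟨h1, h2⟩, hret⟩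
  · exact Or.inr fun s hs => hret.1 s (by omega)

/-! ### The law of the sampled items -/

/-- The probability that the first `t` sampled items are `X`, for fixed internal randomness. -/
noncomputable def law (r : Ω) (t : ℕ) (X : Fin t → Fin n) : ℝ :=
  (I.supply {x | A.sampled I r x t = X}).toReal

theorem measurableSet_sampled_eq (r : Ω) (t : ℕ) (X : Fin t → Fin n) :
    MeasurableSet {x | A.sampled I r x t = X} :=
  ((A.measurable_sampled I t).comp measurable_prodMk_left) (measurableSet_singleton X)

theorem sampled_succ_eq_snoc_iff (r : Ω) (x : ℕ → Fin n × Fin n) {t : ℕ} (X : Fin t → Fin n)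
    (a : Fin n) :
    A.sampled I r x (t + 1) = Fin.snoc (α := fun _ => Fin n) X a ↔
      A.sampled I r x t = X ∧ (A.nextKind I r X).select (x t) = a := by
  rw [sampled_succ, Fin.snoc_inj]
  refine and_congr_right fun h => ?_
  rw [h]

theorem setOf_sampled_eq_snoc (r : Ω) {t : ℕ} {X : Fin t → Fin n} {B : ℕ → Set (Fin n × Fin n)}
    (hB : {x | A.sampled I r x t = X} = Set.pi (Finset.range t : Set ℕ) B) (a : Fin n) :
    {x | A.sampled I r x (t + 1) = Fin.snoc (α := fun _ => Fin n) X a} =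
      Set.pi (Finset.range (t + 1) : Set ℕ)
        (Function.update B t {z | (A.nextKind I r X).select z = a}) := by
  ext x
  have hB' := Set.ext_iff.1 hB x
  simp only [Set.mem_ofPred_eq, Set.mem_pi, Finset.coe_range, Set.mem_Iio] at hB' ⊢
  rw [sampled_succ_eq_snoc_iff]
  constructor
  · rintro ⟨h1, h2⟩ i hi
    rcases Nat.lt_succ_iff_lt_or_eq.1 hi with h | rfl
    · rw [Function.update_of_ne h.ne]
      exact hB'.1 h1 i h
    · rw [Function.update_self]
      exact h2
  · intro h
    refine ⟨hB'.2 fun i hi => ?_, ?_⟩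
    · have := h i (by omega)
      rwa [Function.update_of_ne hi.ne] at this
    · have := h t (by omega)
      rwa [Function.update_self] at this

/-- For fixed internal randomness, prescribing the items `X` determines every choice of kind along
the way. The event therefore constrains each coordinate of the supply separately, and independence
gives the product formula `law_snoc` despite adaptivity. -/
theorem exists_cylinder (r : Ω) (t : ℕ) (X : Fin t → Fin n) :
    ∃ B : ℕ → Set (Fin n × Fin n),
      {x | A.sampled I r x t = X} = Set.pi (Finset.range t : Set ℕ) B := by
  induction t with
  | zero => exact ⟨fun _ => Set.univ, by ext x; simp; exact Subsingleton.elim _ _⟩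
  | succ t ih =>
    obtain ⟨B, hB⟩ := ih (Fin.init X)
    rw [← Fin.snoc_init_self X]
    exact ⟨_, A.setOf_sampled_eq_snoc I r hB _⟩

theorem law_snoc (r : Ω) (t : ℕ) (X : Fin t → Fin n) (a : Fin n) :
    A.law I r (t + 1) (Fin.snoc (α := fun _ => Fin n) X a) =
      A.law I r t X * I.prob (A.nextKind I r X) a := by
  obtain ⟨B, hB⟩ := A.exists_cylinder I r t X
  rw [law, law, A.setOf_sampled_eq_snoc I r hB a, hB, SumInstance.supply,
    Measure.infinitePi_pi _ (fun _ _ => .of_discrete),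
    Measure.infinitePi_pi _ (fun _ _ => .of_discrete), Finset.prod_range_succ,
    Function.update_self, ENNReal.toReal_mul, I.measure_select_eq]
  congr 2
  refine Finset.prod_congr rfl fun i hi => ?_
  rw [Function.update_of_ne (Finset.mem_range.1 hi).ne]

theorem sum_law_succ (r : Ω) (t : ℕ) (h : (Fin (t + 1) → Fin n) → ℝ) :
    ∑ X, A.law I r (t + 1) X * h X = ∑ X, A.law I r t X *
      ∑ a, I.prob (A.nextKind I r X) a * h (Fin.snoc (α := fun _ => Fin n) X a) := by
  rw [← (Fin.snocEquiv fun _ : Fin (t + 1) => Fin n).sum_comp, Fintype.sum_prod_type_right]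
  refine Finset.sum_congr rfl fun X _ => ?_
  rw [Finset.mul_sum]
  refine Finset.sum_congr rfl fun a _ => ?_
  have : (Fin.snocEquiv fun _ : Fin (t + 1) => Fin n) (a, X) =
    Fin.snoc (α := fun _ => Fin n) X a := rfl
  rw [this, law_snoc, mul_assoc]

theorem sum_law (r : Ω) (t : ℕ) : ∑ X, A.law I r t X = 1 := by
  have h1 : (∑ X, I.supply ({x | A.sampled I r x t = X})) = 1 := by
    have := sum_measure_preimage_singleton (μ := I.supply) (Finset.univ : Finset (Fin t → Fin n))
      (f := fun x => A.sampled I r x t) (fun X _ => A.measurableSet_sampled_eq I r t X)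
    simp only [Finset.coe_univ, Set.preimage_univ, measure_univ] at this
    exact this
  have h2 := congrArg ENNReal.toReal h1
  rw [ENNReal.toReal_sum (fun _ _ => measure_ne_top _ _)] at h2
  simpa [law] using h2

open Classical in
theorem measure_sampled_mem (r : Ω) (t : ℕ) (D : (Fin t → Fin n) → Prop) :
    (I.supply {x | D (A.sampled I r x t)}).toReal =
      ∑ X, A.law I r t X * if D X then 1 else 0 := by
  have := sum_measure_preimage_singleton (μ := I.supply)
      (Finset.univ.filter D : Finset (Fin t → Fin n))
      (f := fun x => A.sampled I r x t) (fun X _ => A.measurableSet_sampled_eq I r t X)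
  have h2 := congrArg ENNReal.toReal this
  rw [ENNReal.toReal_sum (fun _ _ => measure_ne_top _ _)] at h2
  simp only [mul_ite, mul_one, mul_zero]
  rw [← Finset.sum_filter]
  refine Eq.trans ?_ h2.symm
  congr 2
  ext x
  simp

end HybridAlgorithm

/-! ### Comparing one step on two instances -/

/-- The positions `i` at which `X` takes a value of weight `τ` for the first time. -/
noncomputable def firstOccurrences {n t : ℕ} (w : Fin n → ℝ≥0) (τ : ℝ≥0) (X : Fin t → Fin n) :
    Finset (Fin t) :=
  Finset.univ.filter fun i => w (X i) = τ ∧ ∀ j < i, X j ≠ X i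

theorem injOn_firstOccurrences {n t : ℕ} (w : Fin n → ℝ≥0) (τ : ℝ≥0) (X : Fin t → Fin n) :
    Set.InjOn X (firstOccurrences w τ X) := by
  intro i hi j hj hij
  simp only [firstOccurrences, Finset.coe_filter, Finset.mem_univ, true_and,
    Set.mem_ofPred_eq] at hi hj
  rcases lt_trichotomy i j with h | h | h
  · exact absurd hij (hj.2 i h)
  · exact h
  · exact absurd hij.symm (hi.2 j h)

theorem mem_image_firstOccurrences {n t : ℕ} (w : Fin n → ℝ≥0) (τ : ℝ≥0) (X : Fin t → Fin n)
    (a : Fin n) :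
    a ∈ (firstOccurrences w τ X).image X ↔ w a = τ ∧ ∃ i, X i = a := by
  simp only [firstOccurrences, Finset.mem_image, Finset.mem_filter, Finset.mem_univ, true_and]
  constructor
  · rintro ⟨i, ⟨h1, -⟩, rfl⟩
    exact ⟨h1, i, rfl⟩
  · rintro ⟨h1, h2⟩
    obtain ⟨i, hi, hmin⟩ := (Finset.univ.filter fun i => X i = a).exists_minimal
      (by obtain ⟨i, hi⟩ := h2; exact ⟨i, by simpa using hi⟩)
    simp only [Finset.mem_filter, Finset.mem_univ, true_and] at hi hmin
    refine ⟨i, ⟨hi ▸ h1, fun j hj he => ?_⟩, hi⟩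
    exact absurd (hmin (he.trans hi) hj.le) (not_le.2 hj)

/-- Cauchy-Schwarz for two blocks. It merges seen with unseen items, and later the two weight
classes. -/
theorem add_sq_le_add_mul_add {x y a b c d : ℝ} (ha : 0 ≤ a) (hb : 0 ≤ b) (hc : 0 ≤ c)
    (hd : 0 ≤ d) (h1 : x ^ 2 ≤ a * c) (h2 : y ^ 2 ≤ b * d) :
    (x + y) ^ 2 ≤ (a + b) * (c + d) := by
  have := Finset.sum_sq_le_sum_mul_sum_of_sq_le_mul (Finset.univ : Finset (Fin 2))
    (r := ![x, y]) (f := ![a, b]) (g := ![c, d])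
    (by intro i _; fin_cases i <;> simpa) (by intro i _; fin_cases i <;> simpa)
    (by intro i _; fin_cases i <;> simpa)
  simpa using this

/-- Meant for unseen items of one weight: they are interchangeable, so the pointwise bound holds for
all pairs in `N × N'`. Averaging over the pairs and applying Cauchy-Schwarz on `N'` gives the
factor. -/
theorem sum_sq_le_card_sq_div_card_mul_sum {ι : Type*} (N N' : Finset ι) (hN : N.Nonempty)
    {V G : ι → ℝ} (h : ∀ a ∈ N, ∀ a' ∈ N', V a' ^ 2 ≤ G a) :
    (∑ a ∈ N', V a) ^ 2 ≤ (N'.card : ℝ) ^ 2 / N.card * ∑ a ∈ N, G a := by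
  have hpos : (0 : ℝ) < N.card := by exact_mod_cast hN.card_pos
  have h1 : (N.card : ℝ) * ∑ a ∈ N', V a ^ 2 ≤ N'.card * ∑ a ∈ N, G a := by
    calc (N.card : ℝ) * ∑ a ∈ N', V a ^ 2 = ∑ a ∈ N, ∑ a' ∈ N', V a' ^ 2 := by simp
      _ ≤ ∑ a ∈ N, ∑ a' ∈ N', G a :=
        Finset.sum_le_sum fun a ha => Finset.sum_le_sum fun a' ha' => h a ha a' ha'
      _ = N'.card * ∑ a ∈ N, G a := by simp [Finset.mul_sum]
  have h2 := sq_sum_le_card_mul_sum_sq (s := N') (f := V)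
  rw [div_mul_eq_mul_div, le_div_iff₀ hpos]
  calc (∑ a ∈ N', V a) ^ 2 * N.card ≤ (N'.card * ∑ a ∈ N', V a ^ 2) * N.card := by gcongr
    _ = N'.card * (N.card * ∑ a ∈ N', V a ^ 2) := by ring
    _ ≤ N'.card * (N'.card * ∑ a ∈ N, G a) := by gcongr
    _ = _ := by ring

/-- If two sequences of items look the same, then the sum of `V` over the items of weight `τ` in
one weighting is controlled by the corresponding sum of `G` in the other weighting, where `V ^ 2`
is at most `G` on every pair of items that extend the sequences in the same way. -/
theorem sum_filter_sq_le {n t : ℕ} {w w' : Fin n → ℝ≥0} {X X' : Fin t → Fin n}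
    (hw : ∀ i, w (X i) = w' (X' i)) (he : ∀ i j, X i = X j ↔ X' i = X' j)
    {V G : Fin n → ℝ} (hG : ∀ a, 0 ≤ G a)
    (hVG : ∀ a a', w a = w' a' → (∀ i, X i = a ↔ X' i = a') → V a' ^ 2 ≤ G a)
    (τ : ℝ≥0) {c d : ℝ} (hc : ((Finset.univ.filter fun a => w a = τ).card : ℝ) = c)
    (hc' : ((Finset.univ.filter fun a => w' a = τ).card : ℝ) = c + d) (ht : (t : ℝ) < c) :
    (∑ a with w' a = τ, V a) ^ 2 ≤ (c + 2 * d + d ^ 2 / (c - t)) * ∑ a with w a = τ, G a := by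
  classical
  set C := Finset.univ.filter fun a => w a = τ with hC
  set C' := Finset.univ.filter fun a => w' a = τ with hC'
  set R := firstOccurrences w τ X with hR
  -- First occurrences are determined by the view, so the same index set enumerates the seen items
  -- of weight `τ` in both instances.
  have hR' : R = firstOccurrences w' τ X' := by
    ext i
    simp only [hR, firstOccurrences, Finset.mem_filter, Finset.mem_univ, true_and, hw, ne_eq, he]
  set O := R.image X with hO
  set O' := R.image X' with hO'
  have hinj : Set.InjOn X R := injOn_firstOccurrences w τ X
  have hinj' : Set.InjOn X' R := hR' ▸ injOn_firstOccurrences w' τ X'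
  have hmem : ∀ a, a ∈ O ↔ w a = τ ∧ ∃ i, X i = a := mem_image_firstOccurrences w τ X
  have hmem' : ∀ a, a ∈ O' ↔ w' a = τ ∧ ∃ i, X' i = a := by
    rw [hO', hR']; exact mem_image_firstOccurrences w' τ X'
  have hsub : O ⊆ C := fun a ha => by simp [hC, ((hmem a).1 ha).1]
  have hsub' : O' ⊆ C' := fun a ha => by simp [hC', ((hmem' a).1 ha).1]
  have hcardO : O.card = R.card := Finset.card_image_of_injOn hinj
  have hcardO' : O'.card = R.card := Finset.card_image_of_injOn hinj'
  have hRt : (R.card : ℝ) ≤ t := by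
    have := Finset.card_le_univ R
    rw [Fintype.card_fin] at this
    exact_mod_cast this
  have hN : ((C \ O).card : ℝ) = c - R.card := by
    rw [Finset.cast_card_sdiff hsub, hcardO, hc]
  have hN' : ((C' \ O').card : ℝ) = c + d - R.card := by
    rw [Finset.cast_card_sdiff hsub', hcardO', hc']
  have hpos : 0 < c - R.card := by linarith
  rw [← Finset.sum_sdiff hsub, ← Finset.sum_sdiff hsub', Finset.sum_image hinj,
    Finset.sum_image hinj']
  have hold : (∑ i ∈ R, V (X' i)) ^ 2 ≤ R.card * ∑ i ∈ R, G (X i) := by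
    refine sq_sum_le_card_mul_sum_sq.trans ?_
    gcongr with i hi
    exact hVG _ _ (hw i) fun j => he j i
  have hnew : (∑ a ∈ C' \ O', V a) ^ 2 ≤
      (c + d - R.card) ^ 2 / (c - R.card) * ∑ a ∈ C \ O, G a := by
    rw [← hN, ← hN']
    refine sum_sq_le_card_sq_div_card_mul_sum _ _ ?_ fun a ha a' ha' => ?_
    · rw [← Finset.card_pos]
      exact_mod_cast hN ▸ hpos
    · simp only [hC, hC', Finset.mem_sdiff, Finset.mem_filter, Finset.mem_univ, true_and, hmem,
        hmem', not_and, not_exists] at ha ha'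
      exact hVG _ _ (ha.1.trans ha'.1.symm)
        fun i => iff_of_false (ha.2 ha.1 i) (ha'.2 ha'.1 i)
  have key := add_sq_le_add_mul_add (by positivity) (by positivity)
    (Finset.sum_nonneg fun a _ => hG a) (Finset.sum_nonneg fun i _ => hG _) hnew hold
  refine key.trans (mul_le_mul_of_nonneg_right ?_
    (add_nonneg (Finset.sum_nonneg fun a _ => hG a) (Finset.sum_nonneg fun i _ => hG _)))
  -- The number of seen items enters only through the denominator of the quadratic term.
  have : (c + d - R.card) ^ 2 / (c - R.card) + R.card = c + 2 * d + d ^ 2 / (c - R.card) := by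
    field_simp
    ring
  rw [this]
  have : d ^ 2 / (c - R.card) ≤ d ^ 2 / (c - t) := by
    gcongr
  linarith

/-! ### Zero-one instances and the bound for one sample -/

namespace SumInstance

/-- The instance with `s` items of weight `1` and `n - s` items of weight `0`. -/
noncomputable def zeroOne (n s : ℕ) (hs : 0 < s) (hsn : s ≤ n) : SumInstance n where
  w a := if (a : ℕ) < s then 1 else 0
  sum_pos := by
    refine Finset.sum_pos' (fun _ _ => zero_le) ⟨⟨0, by omega⟩, Finset.mem_univ _, ?_⟩
    simp [hs]

variable {n s : ℕ} (hs : 0 < s) (hsn : s ≤ n)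

theorem zeroOne_w_eq (a : Fin n) :
    (zeroOne n s hs hsn).w a = 0 ∨ (zeroOne n s hs hsn).w a = 1 := by
  simp only [zeroOne]
  split_ifs <;> simp

theorem card_filter_zeroOne_one :
    (Finset.univ.filter fun a => (zeroOne n s hs hsn).w a = 1).card = s := by
  simp only [zeroOne, ite_eq_left_iff, zero_ne_one, imp_false, not_not]
  rw [Fin.card_filter_val_lt]
  exact min_eq_right hsn

theorem card_filter_zeroOne_zero :
    (Finset.univ.filter fun a => (zeroOne n s hs hsn).w a = 0).card = n - s := by
  have h := card_filter_zeroOne_one hs hsn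
  have h2 := Finset.card_filter_add_card_filter_not (s := (Finset.univ : Finset (Fin n)))
    (fun a => (zeroOne n s hs hsn).w a = 1)
  have h3 : (Finset.univ.filter fun a => ¬ (zeroOne n s hs hsn).w a = 1) =
      Finset.univ.filter fun a => (zeroOne n s hs hsn).w a = 0 := by
    ext a
    rcases zeroOne_w_eq hs hsn a with h | h <;> simp [h]
  rw [h3, h, Finset.card_univ, Fintype.card_fin] at h2
  omega

theorem sum_zeroOne (f : Fin n → ℝ) :
    ∑ a, f a = ∑ a with (zeroOne n s hs hsn).w a = 1, f a +
      ∑ a with (zeroOne n s hs hsn).w a = 0, f a := by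
  rw [← Finset.sum_filter_add_sum_filter_not _ (fun a => (zeroOne n s hs hsn).w a = 1)]
  congr 2
  ext a
  rcases zeroOne_w_eq hs hsn a with h | h <;> simp [h]

theorem total_zeroOne : (zeroOne n s hs hsn).total = s := by
  have h1 : ∀ a ∈ Finset.univ.filter fun a => (zeroOne n s hs hsn).w a = 1,
      ((zeroOne n s hs hsn).w a : ℝ) = 1 := fun a ha => by
    rw [(Finset.mem_filter.1 ha).2, NNReal.coe_one]
  have h0 : ∀ a ∈ Finset.univ.filter fun a => (zeroOne n s hs hsn).w a = 0,
      ((zeroOne n s hs hsn).w a : ℝ) = 0 := fun a ha => by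
    rw [(Finset.mem_filter.1 ha).2, NNReal.coe_zero]
  rw [total, sum_zeroOne hs hsn, Finset.sum_congr rfl h1, Finset.sum_congr rfl h0]
  simp [card_filter_zeroOne_one]

theorem sum_prob_proportional_zeroOne (f : Fin n → ℝ) :
    ∑ a, (zeroOne n s hs hsn).prob SampleKind.proportional a * f a =
      (∑ a with (zeroOne n s hs hsn).w a = 1, f a) / s := by
  have h0 : ∑ a with (zeroOne n s hs hsn).w a = 0,
      (zeroOne n s hs hsn).prob SampleKind.proportional a * f a = 0 := by
    refine Finset.sum_eq_zero fun a ha => ?_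
    rw [prob_proportional, (Finset.mem_filter.1 ha).2]
    simp
  rw [sum_zeroOne hs hsn, h0, add_zero, Finset.sum_div]
  refine Finset.sum_congr rfl fun a ha => ?_
  rw [prob_proportional, total_zeroOne, (Finset.mem_filter.1 ha).2]
  simp [div_eq_inv_mul]

theorem sum_prob_uniform (I : SumInstance n) (f : Fin n → ℝ) :
    ∑ a, I.prob SampleKind.uniform a * f a = (∑ a, f a) / n := by
  rw [Finset.sum_div]
  refine Finset.sum_congr rfl fun a _ => ?_
  rw [prob_uniform]
  ring

theorem view_eq_iff {I I' : SumInstance n} {t : ℕ} {X X' : Fin t → Fin n} :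
    I.view X = I'.view X' ↔
      (∀ i, I.w (X i) = I'.w (X' i)) ∧ ∀ i j, X i = X j ↔ X' i = X' j := by
  simp only [view, Prod.mk.injEq, funext_iff, decide_eq_decide, NNReal.coe_inj]

theorem view_snoc_eq {I I' : SumInstance n} {t : ℕ} {X X' : Fin t → Fin n}
    (h : I.view X = I'.view X') {a a' : Fin n} (hw : I.w a = I'.w a')
    (he : ∀ i, X i = a ↔ X' i = a') :
    I.view (Fin.snoc (α := fun _ => Fin n) X a) = I'.view (Fin.snoc (α := fun _ => Fin n) X' a') := by
  rw [view_eq_iff] at h ⊢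
  refine ⟨fun i => ?_, fun i j => ?_⟩
  · refine Fin.lastCases ?_ (fun i => ?_) i
    · simpa using hw
    · simpa using h.1 i
  · refine Fin.lastCases ?_ (fun i => ?_) i <;> refine Fin.lastCases ?_ (fun j => ?_) j
    · simp
    · simpa [eq_comm] using he j
    · simpa using he i
    · simpa using h.2 i j

theorem view_castLE {I I' : SumInstance n} {s t : ℕ} {X X' : Fin t → Fin n}
    (h : I.view X = I'.view X') (hst : s ≤ t) :
    I.view (fun i => X (Fin.castLE hst i)) = I'.view (fun i => X' (Fin.castLE hst i)) := by
  rw [view_eq_iff] at h ⊢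
  exact ⟨fun i => h.1 _, fun i j => h.2 _ _⟩

/-- The second moment bound for one sample of either kind. -/
theorem sum_prob_zeroOne_sq_le {d m t : ℕ} (hs' : 0 < s + d) (hsn' : s + d ≤ n) {δ : ℝ}
    (ht : t ≤ m) (hms : m < s) (hmn : s + m < n)
    (hδ1 : (m : ℝ) * d ^ 2 / ((s - m) * (s + d) ^ 2) ≤ δ)
    (hδ2 : (d : ℝ) ^ 2 * (1 / (s - m) + 1 / (n - s - m)) ≤ δ * n)
    {X X' : Fin t → Fin n} (hX : (zeroOne n s hs hsn).view X = (zeroOne n (s + d) hs' hsn').view X')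
    (k : SampleKind) {V G : Fin n → ℝ} (hG : ∀ a, 0 ≤ G a)
    (hVG : ∀ a a', (zeroOne n s hs hsn).w a = (zeroOne n (s + d) hs' hsn').w a' →
      (∀ i, X i = a ↔ X' i = a') → V a' ^ 2 ≤ G a) :
    (∑ a, (zeroOne n (s + d) hs' hsn').prob k a * V a) ^ 2 ≤
      (1 + δ) * ∑ a, (zeroOne n s hs hsn).prob k a * G a := by
  rw [view_eq_iff] at hX
  have hs0 : (0 : ℝ) < s := by exact_mod_cast hs
  have htm : (t : ℝ) ≤ m := by exact_mod_cast ht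
  have hms' : (m : ℝ) < s := by exact_mod_cast hms
  have hmn' : (s : ℝ) + m < n := by exact_mod_cast hmn
  have hd0 : (0 : ℝ) ≤ d := by positivity
  have hn0 : (0 : ℝ) < n := by linarith [(Nat.cast_nonneg m : (0 : ℝ) ≤ m)]
  have hone := sum_filter_sq_le hX.1 hX.2 hG hVG 1 (c := s) (d := d)
    (by rw [card_filter_zeroOne_one]) (by rw [card_filter_zeroOne_one]; push_cast; rfl)
    (by linarith)
  -- The class of zeros loses the `d` items that the class of ones gains.
  have hzero := sum_filter_sq_le hX.1 hX.2 hG hVG 0 (c := n - s) (d := -d)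
    (by rw [card_filter_zeroOne_zero, Nat.cast_sub hsn])
    (by rw [card_filter_zeroOne_zero, Nat.cast_sub hsn']; push_cast; ring) (by linarith)
  set Z1 := ∑ a with (zeroOne n (s + d) hs' hsn').w a = 1, V a
  set Z0 := ∑ a with (zeroOne n (s + d) hs' hsn').w a = 0, V a
  set Y1 := ∑ a with (zeroOne n s hs hsn).w a = 1, G a with hY1
  set Y0 := ∑ a with (zeroOne n s hs hsn).w a = 0, G a with hY0
  have hY1n : 0 ≤ Y1 := Finset.sum_nonneg fun a _ => hG a
  have hY0n : 0 ≤ Y0 := Finset.sum_nonneg fun a _ => hG a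
  have hle1 : (d : ℝ) ^ 2 / (s - t) ≤ d ^ 2 / (s - m) := by
    gcongr
  have hle0 : (-d : ℝ) ^ 2 / (n - s - t) ≤ d ^ 2 / (n - s - m) := by
    rw [neg_sq]
    gcongr
    linarith
  have hone' : Z1 ^ 2 ≤ (s + 2 * d + d ^ 2 / (s - m)) * Y1 :=
    hone.trans (mul_le_mul_of_nonneg_right (by linarith) hY1n)
  have hzero' : Z0 ^ 2 ≤ (n - s - 2 * d + d ^ 2 / (n - s - m)) * Y0 :=
    hzero.trans (mul_le_mul_of_nonneg_right (by linarith) hY0n)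
  cases k with
  | proportional =>
    rw [sum_prob_proportional_zeroOne, sum_prob_proportional_zeroOne]
    push_cast
    rw [div_pow, div_le_iff₀ (by positivity)]
    refine hone'.trans ?_
    have hsm : (0 : ℝ) < s - m := by linarith
    -- The normalisation `(s + d) ^ 2 / s` absorbs the linear term; what remains vanishes for `m =
    -- 0`, since without earlier samples there are no collisions.
    have e : (s + 2 * d + d ^ 2 / (s - m) : ℝ) =
        (1 + m * d ^ 2 / ((s - m) * (s + d) ^ 2)) / s * (s + d) ^ 2 := by
      field_simp
      ring
    rw [e]
    calc _ ≤ (1 + δ) / s * (s + d : ℝ) ^ 2 * Y1 := by gcongr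
      _ = _ := by ring
  | uniform =>
    rw [sum_prob_uniform, sum_prob_uniform, sum_zeroOne hs' hsn' V, sum_zeroOne hs hsn G]
    have h0 : (0 : ℝ) ≤ n - s - 2 * d + d ^ 2 / (n - s - m) := by
      have h1 : (0 : ℝ) < n - s - m := by linarith
      have h2 : (n - s - 2 * d + d ^ 2 / (n - s - m) : ℝ) =
          ((n - s - m - d) ^ 2 + m * (n - s - m)) / (n - s - m) := by
        field_simp
        ring
      rw [h2]
      positivity
    have h1 : (0 : ℝ) ≤ s + 2 * d + d ^ 2 / (s - m) := by
      have : (0 : ℝ) < s - m := by linarith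
      positivity
    -- Adding the two classes cancels `2 * d` against `-2 * d`.
    have key := add_sq_le_add_mul_add h1 h0 hY1n hY0n hone' hzero'
    rw [div_pow, div_le_iff₀ (by positivity)]
    refine key.trans ?_
    have e : (1 + δ) * ((Y1 + Y0) / n) * (n : ℝ) ^ 2 = (n + δ * n) * (Y1 + Y0) := by
      field_simp
    rw [e]
    refine mul_le_mul_of_nonneg_right ?_ (by linarith)
    have e2 : (d : ℝ) ^ 2 * (1 / (s - m) + 1 / (n - s - m)) =
      d ^ 2 / (s - m) + d ^ 2 / (n - s - m) := by ring
    linarith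

end SumInstance

/-! ### Second moments along an adaptive run -/

namespace HybridAlgorithm

variable {Ω : Type*} [MeasurableSpace Ω] (A : HybridAlgorithm Ω) {n : ℕ}

/-- The first `m` samples of a run on `I` and on `I'` are hard to tell apart: the likelihood ratio of
what the algorithm sees has second moment at most `K`. -/
def SecondMomentLE (I I' : SumInstance n) (r : Ω) (m : ℕ) (K : ℝ) : Prop :=
  ∀ H G : (Fin m → Fin n) → ℝ, (∀ X, 0 ≤ G X) →
    (∀ X X', I.view X = I'.view X' → H X' ^ 2 ≤ G X) →
    (∑ X, A.law I' r m X * H X) ^ 2 ≤ K * ∑ X, A.law I r m X * G X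

theorem secondMomentLE_zero (I I' : SumInstance n) (r : Ω) : A.SecondMomentLE I I' r 0 1 := by
  intro H G _ h
  have h1 := A.sum_law I r 0
  have h2 := A.sum_law I' r 0
  simp only [Finset.univ_unique, Finset.sum_singleton] at h1 h2 ⊢
  rw [h1, h2, one_mul, one_mul, one_mul]
  exact h _ _ (SumInstance.view_eq_iff.2 ⟨fun i => i.elim0, fun i => i.elim0⟩)

theorem secondMomentLE_zeroOne {s d m : ℕ} (hs : 0 < s) (hsn : s ≤ n) (hs' : 0 < s + d)
    (hsn' : s + d ≤ n) {δ : ℝ} (hδ : 0 ≤ δ) (hms : m < s) (hmn : s + m < n)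
    (hδ1 : (m : ℝ) * d ^ 2 / ((s - m) * (s + d) ^ 2) ≤ δ)
    (hδ2 : (d : ℝ) ^ 2 * (1 / (s - m) + 1 / (n - s - m)) ≤ δ * n) (r : Ω) {t : ℕ} (ht : t ≤ m) :
    A.SecondMomentLE (SumInstance.zeroOne n s hs hsn) (SumInstance.zeroOne n (s + d) hs' hsn') r t
      ((1 + δ) ^ t) := by
  induction t with
  | zero => simpa using A.secondMomentLE_zero _ _ r
  | succ t ih =>
    intro H G hG h
    set I := SumInstance.zeroOne n s hs hsn
    set I' := SumInstance.zeroOne n (s + d) hs' hsn'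
    rw [sum_law_succ, sum_law_succ]
    -- The average of `H` over the last sample becomes the new test function; the one-sample bound
    -- shows that its square is dominated by `1 + δ` times the average of `G`.
    refine (ih (by omega) _ (fun X => (1 + δ) * ∑ a, I.prob (A.nextKind I r X) a *
      G (Fin.snoc (α := fun _ => Fin n) X a)) (fun X => ?_) fun X X' hX => ?_).trans_eq ?_
    · exact mul_nonneg (by linarith)
        (Finset.sum_nonneg fun a _ => mul_nonneg (I.prob_nonneg _ _) (hG _))
    · have hk : A.nextKind I' r X' = A.nextKind I r X := by rw [nextKind, nextKind, hX]
      rw [hk]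
      exact SumInstance.sum_prob_zeroOne_sq_le hs hsn hs' hsn' (by omega) hms hmn hδ1 hδ2 hX _
        (fun a => hG _) fun a a' hw he => h _ _ (SumInstance.view_snoc_eq hX hw he)
    · rw [pow_succ, mul_assoc, Finset.mul_sum (a := 1 + δ)]
      congr 1
      refine Finset.sum_congr rfl fun X _ => ?_
      ring

/-! ### From second moments to probabilities of outputs -/

/-- After the samples `X`, the algorithm has returned an element of `J`. -/
def HasReturned (I : SumInstance n) (r : Ω) (J : Set ℝ) {m : ℕ} (X : Fin m → Fin n) : Prop :=
  ∃ (t : ℕ) (ht : t ≤ m), ∃ y ∈ J,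
    (∀ (s : ℕ) (hs : s < t),
      (A.step s (r, I.view fun i => X (Fin.castLE (hs.le.trans ht) i))).isLeft) ∧
    A.step t (r, I.view fun i => X (Fin.castLE ht i)) = Sum.inr y

theorem mem_returnsWithin_iff (I : SumInstance n) (r : Ω) (x : ℕ → Fin n × Fin n) (m : ℕ)
    (J : Set ℝ) :
    (r, x) ∈ A.returnsWithin I m J ↔ A.HasReturned I r J (A.sampled I r x m) := by
  simp only [returnsWithin, HasReturned, Returns, action, sampled_castLE, Set.mem_ofPred_eq,
    exists_prop]

/-- The output depends on the items only through their view, so its indicator may serve in the test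
functions of `SecondMomentLE`. -/
theorem hasReturned_congr {I I' : SumInstance n} (r : Ω) (J : Set ℝ) {m : ℕ}
    {X X' : Fin m → Fin n} (h : I.view X = I'.view X') :
    A.HasReturned I r J X ↔ A.HasReturned I' r J X' := by
  simp only [HasReturned, SumInstance.view_castLE h]

theorem measure_section_le {I I' : SumInstance n} {m : ℕ} {K : ℝ} {r : Ω}
    (h : A.SecondMomentLE I I' r m K) (hK : K ≤ 21 / 20) (J : Set ℝ) :
    I'.supply (Prod.mk r ⁻¹' A.returnsWithin I' m J) ≤
      ENNReal.ofReal (1 / 10) +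
        ENNReal.ofReal (21 / 20) * I.supply (Prod.mk r ⁻¹' A.returnsWithin I m J) := by
  classical
  have e : ∀ I : SumInstance n, (I.supply (Prod.mk r ⁻¹' A.returnsWithin I m J)).toReal =
      ∑ X, A.law I r m X * if A.HasReturned I r J X then 1 else 0 := by
    intro I
    rw [← A.measure_sampled_mem]
    congr 2
    ext x
    exact A.mem_returnsWithin_iff I r x m J
  -- The test function is `2 / 3 * (1 + indicator)`, with `G` its square. Its mean is `1` at
  -- probability `1 / 2`, where the tangent bound `2 * x - 1 ≤ x ^ 2` used below is sharp.
  have key := h (fun X => if A.HasReturned I' r J X then 4 / 3 else 2 / 3)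
    (fun X => if A.HasReturned I r J X then 16 / 9 else 4 / 9)
    (fun X => by split_ifs <;> norm_num)
    (fun X X' hX => by
      simp only [A.hasReturned_congr r J hX]
      split_ifs <;> norm_num)
  have e' : ∀ (I : SumInstance n) (α β : ℝ),
      ∑ X, A.law I r m X * (if A.HasReturned I r J X then α else β) =
        β + (α - β) * (I.supply (Prod.mk r ⁻¹' A.returnsWithin I m J)).toReal := by
    intro I α β
    calc _ = β * ∑ X, A.law I r m X +
          (α - β) * ∑ X, A.law I r m X * (if A.HasReturned I r J X then 1 else 0) := by
          rw [Finset.mul_sum, Finset.mul_sum, ← Finset.sum_add_distrib]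
          refine Finset.sum_congr rfl fun X _ => ?_
          split_ifs <;> ring
      _ = _ := by rw [A.sum_law, mul_one, ← e]
  rw [e', e'] at key
  set p' := (I'.supply (Prod.mk r ⁻¹' A.returnsWithin I' m J)).toReal with hp'
  set p := (I.supply (Prod.mk r ⁻¹' A.returnsWithin I m J)).toReal with hp
  have hp0 : 0 ≤ p := ENNReal.toReal_nonneg
  have hfin : p' ≤ 1 / 10 + 21 / 20 * p := by
    have h1 : K * (4 / 9 + (16 / 9 - 4 / 9) * p) ≤ 21 / 20 * (4 / 9 + (16 / 9 - 4 / 9) * p) :=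
      mul_le_mul_of_nonneg_right hK (by linarith)
    nlinarith [sq_nonneg (2 / 3 + (4 / 3 - 2 / 3) * p' - 1)]
  rw [← ENNReal.ofReal_toReal (measure_ne_top I'.supply _),
    ← ENNReal.ofReal_toReal (measure_ne_top I.supply _), ← hp, ← hp',
    ← ENNReal.ofReal_mul (by norm_num), ← ENNReal.ofReal_add (by norm_num) (by positivity)]
  exact ENNReal.ofReal_le_ofReal hfin

theorem measure_returnsWithin_le {I I' : SumInstance n} {m : ℕ} {K : ℝ} (P : Measure Ω)
    [IsProbabilityMeasure P] (h : ∀ r, A.SecondMomentLE I I' r m K) (hK : K ≤ 21 / 20)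
    {J : Set ℝ} (hJ : MeasurableSet J) :
    (P.prod I'.supply) (A.returnsWithin I' m J) ≤
      ENNReal.ofReal (1 / 10) +
        ENNReal.ofReal (21 / 20) * (P.prod I.supply) (A.returnsWithin I m J) := by
  rw [Measure.prod_apply (A.measurableSet_returnsWithin I' m hJ),
    Measure.prod_apply (A.measurableSet_returnsWithin I m hJ)]
  refine (lintegral_mono fun r => A.measure_section_le (h r) hK J).trans ?_
  rw [lintegral_add_left measurable_const, lintegral_const, measure_univ, mul_one,
    lintegral_const_mul _ (measurable_measure_prodMk_left (A.measurableSet_returnsWithin I m hJ))]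

/-! ### Indistinguishable instances force many samples -/

/-- By Markov, truncation at `m` samples costs less than `1 / 12` of the success probability `2 /
3`. -/
theorem seven_twelfths_le {I : SumInstance n} {P : Measure Ω} [IsProbabilityMeasure P] {ε : ℝ}
    (m : ℕ) (hs : 2 / 3 ≤ A.successProb I P ε)
    (hE : A.expectedSamples I P < ENNReal.ofReal ((m + 1) / 12)) :
    7 / 12 ≤ ((P.prod I.supply)
      (A.returnsWithin I m (Set.Icc ((1 - ε) * I.total) ((1 + ε) * I.total)))).toReal := by
  have h1 := hs.trans (A.successProb_le I P ε m)
  have h2 := (A.mul_measure_runsBeyond_le I P m).trans_lt hE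
  rw [← ENNReal.ofReal_toReal (measure_ne_top (P.prod I.supply) (A.runsBeyond I m))] at h1 h2
  rw [← ENNReal.ofReal_toReal (measure_ne_top (P.prod I.supply) (A.returnsWithin I m _)),
    ← ENNReal.ofReal_add ENNReal.toReal_nonneg ENNReal.toReal_nonneg] at h1
  have e : (2 / 3 : ℝ≥0∞) = ENNReal.ofReal (2 / 3) := by
    rw [ENNReal.ofReal_div_of_pos (by norm_num)]; norm_num
  have e2 : (m : ℝ≥0∞) + 1 = ENNReal.ofReal (m + 1) := by
    rw [ENNReal.ofReal_add (by positivity) (by norm_num)]; simp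
  rw [e, ENNReal.ofReal_le_ofReal_iff (by positivity)] at h1
  rw [e2, ← ENNReal.ofReal_mul (by positivity), ENNReal.ofReal_lt_ofReal_iff (by positivity)] at h2
  have : ((P.prod I.supply) (A.runsBeyond I m)).toReal < 1 / 12 := by
    have hm : (0 : ℝ) < m + 1 := by positivity
    by_contra! hc
    nlinarith
  linarith

/-- An algorithm that is correct on two instances with separated totals takes many samples on one
of them if the first `m` samples cannot tell them apart. -/
theorem le_expectedSamples_of_secondMomentLE {I I' : SumInstance n} {m : ℕ} {K ε : ℝ}
    {P : Measure Ω} [IsProbabilityMeasure P] (h : ∀ r, A.SecondMomentLE I I' r m K)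
    (hK : K ≤ 21 / 20) (hsep : (1 + ε) * I.total < (1 - ε) * I'.total)
    (hs : 2 / 3 ≤ A.successProb I P ε) (hs' : 2 / 3 ≤ A.successProb I' P ε) :
    ENNReal.ofReal ((m + 1) / 12) ≤ A.expectedSamples I P ∨
      ENNReal.ofReal ((m + 1) / 12) ≤ A.expectedSamples I' P := by
  by_contra! hcon
  have h1 := A.seven_twelfths_le m hs hcon.1
  have h2 := A.seven_twelfths_le m hs' hcon.2
  set J := Set.Icc ((1 - ε) * I.total) ((1 + ε) * I.total) with hJ
  set J' := Set.Icc ((1 - ε) * I'.total) ((1 + ε) * I'.total) with hJ'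
  have hdisj : Disjoint J J' := by
    rw [Set.disjoint_left]
    rintro y ⟨_, hy⟩ ⟨hy', _⟩
    linarith
  have h3 : (P.prod I.supply) (A.returnsWithin I m J) +
      (P.prod I.supply) (A.returnsWithin I m J') ≤ 1 := by
    rw [← measure_union (A.disjoint_returnsWithin I m hdisj)
      (A.measurableSet_returnsWithin I m measurableSet_Icc)]
    exact prob_le_one
  have h4 := A.measure_returnsWithin_le P h hK (J := J') measurableSet_Icc
  have h3' := ENNReal.toReal_mono ENNReal.one_ne_top h3
  rw [ENNReal.toReal_add (measure_ne_top _ _) (measure_ne_top _ _), ENNReal.toReal_one] at h3'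
  have h4' := ENNReal.toReal_mono (by finiteness) h4
  rw [ENNReal.toReal_add (by finiteness) (by finiteness), ENNReal.toReal_mul,
    ENNReal.toReal_ofReal (by norm_num), ENNReal.toReal_ofReal (by norm_num)] at h4'
  -- On `I` the set `J'` has probability at most `5 / 12`, hence on `I'` at most `1 / 10 + 21 / 20 *
  -- 5 / 12 < 7 / 12`.
  linarith

theorem successProb_mono (I : SumInstance n) (P : Measure Ω) {ε ε' : ℝ} (h : ε ≤ ε') :
    A.successProb I P ε ≤ A.successProb I P ε' := by
  have h0 : 0 ≤ I.total := Finset.sum_nonneg fun _ _ => NNReal.coe_nonneg _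
  refine measure_mono ?_
  rintro z ⟨t, y, hret, h1, h2⟩
  exact ⟨t, y, hret, le_trans (by gcongr) h1, h2.trans (by gcongr)⟩

end HybridAlgorithm

/-! ### Choice of parameters -/

/-- Numbers `s` and `s + d` of items of weight `1` that can be told apart neither by the collisions
among `m` proportional samples nor by the weights of `m` uniform samples. -/
theorem exists_zeroOne_parameters {κ N e : ℝ} {n m : ℕ} (hκ : 1 ≤ κ) (hN : 0 < N) (he : 0 < e)
    (he1 : e ≤ 1) (hnN : (n : ℝ) = N ^ 3) (hκe : 1 ≤ κ * (1 - e ^ 3)) (hb : 20 * κ ≤ e ^ 2 * N)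
    (hm : m ≤ 1 / (7680 * κ ^ 2) * (N / e ^ 4)) :
    ∃ (s d : ℕ) (δ : ℝ), m < s ∧ s + m < n ∧ s + d ≤ n ∧ (1 + e ^ 3) * s < (1 - e ^ 3) * (s + d) ∧
      0 ≤ δ ∧ (1 + δ) ^ m ≤ 21 / 20 ∧ (m : ℝ) * d ^ 2 / ((s - m) * (s + d) ^ 2) ≤ δ ∧
      (d : ℝ) ^ 2 * (1 / (s - m) + 1 / (n - s - m)) ≤ δ * n := by
  have he2 : e ^ 2 ≤ 1 := pow_le_one₀ he.le he1
  have hN1 : 1 ≤ N := by nlinarith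
  set γ := 1 / (7680 * κ ^ 2) with hγ
  have hγ0 : 0 < γ := by positivity
  have hκγ : κ ^ 2 * γ = 1 / 7680 := by rw [hγ]; field_simp
  have hγ1 : γ ≤ 1 / 7680 := by nlinarith [one_le_pow₀ hκ (n := 2)]
  -- The scale of `s` that balances collisions against frequencies when `m` is of order `N / e ^ 4`.
  set σ := N ^ 2 / e ^ 2 with hσ
  have hσ1 : 1 ≤ σ := by
    rw [hσ, one_le_div (by positivity)]
    nlinarith
  have hσe : 1 ≤ e ^ 3 * σ := by
    have : e ^ 3 * σ = e * N ^ 2 := by rw [hσ]; field_simp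
    rw [this]
    have h1 : e ^ 2 * N ≤ e * N ^ 2 := by
      calc e ^ 2 * N = (e * N) * e := by ring
        _ ≤ (e * N) * N := by gcongr; linarith
        _ = _ := by ring
    linarith
  have hσn : 20 * κ * σ ≤ n := by
    have : (n : ℝ) = e ^ 2 * N * σ := by rw [hnN, hσ]; field_simp
    rw [this]
    gcongr
  obtain ⟨s, hsσ, hsσ'⟩ : ∃ s : ℕ, σ ≤ s ∧ (s : ℝ) ≤ 2 * σ :=
    ⟨⌈σ⌉₊, Nat.le_ceil σ, by linarith [Nat.ceil_lt_add_one (zero_le_one.trans hσ1)]⟩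
  have hs1 : (1 : ℝ) ≤ s := hσ1.trans hsσ
  have hes : 1 ≤ e ^ 3 * s := hσe.trans (by gcongr)
  have he3 : e ^ 3 ≤ 1 := pow_le_one₀ he.le he1
  -- Separation needs `(1 - e ^ 3) * d > 2 * e ^ 3 * s`; the factor `3` makes it strict, and
  -- rounding up is absorbed because `e ^ 3 * s ≥ 1`.
  obtain ⟨d, hd1, hd2⟩ : ∃ d : ℕ, 3 * κ * (e ^ 3 * s) ≤ d ∧ (d : ℝ) ≤ 4 * κ * (e ^ 3 * s) := by
    refine ⟨⌈3 * κ * (e ^ 3 * s)⌉₊, Nat.le_ceil _, ?_⟩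
    have := Nat.ceil_lt_add_one (show 0 ≤ 3 * κ * (e ^ 3 * s) by positivity)
    nlinarith
  have hd3 : (d : ℝ) ≤ 4 * κ * s := hd2.trans (by gcongr; nlinarith)
  have hsd : (s : ℝ) + d ≤ n / 2 := by
    have : (s : ℝ) ≤ κ * s := by nlinarith
    have : κ * s ≤ κ * (2 * σ) := by gcongr
    linarith
  have hmσ : (m : ℝ) ≤ γ * σ := by
    refine hm.trans ?_
    gcongr
    rw [hσ, div_le_div_iff₀ (by positivity) (by positivity)]
    calc N * e ^ 2 = N * e ^ 2 * 1 := by ring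
      _ ≤ N * e ^ 2 * (e ^ 2 * N) := by gcongr; linarith
      _ = _ := by ring
  have hms : (m : ℝ) ≤ s / 2 := by nlinarith
  have hm0 : (0 : ℝ) ≤ m := by positivity
  have hn0 : (0 : ℝ) < n := by rw [hnN]; positivity
  have hd0 : (0 : ℝ) ≤ d := by positivity
  -- The two summands pay for a proportional and a uniform sample. As `7680 = 64 * 120`, the total
  -- `m * δ` is at most `(γ + 2) / 120`.
  set δ := 64 * κ ^ 2 * ((e ^ 3) ^ 2 * m / s + (e ^ 3) ^ 2 * s / n) with hδ
  have hδ0 : 0 ≤ δ := by positivity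
  have hmδ : m * δ ≤ 1 / 40 := by
    have h1 : (e ^ 3) ^ 2 * m ^ 2 / s ≤ γ ^ 2 := by
      calc (e ^ 3) ^ 2 * m ^ 2 / s ≤ (e ^ 3) ^ 2 * (γ * (N / e ^ 4)) ^ 2 / σ := by gcongr
        _ = γ ^ 2 := by rw [hσ]; field_simp
    have h2 : (e ^ 3) ^ 2 * (m * s) / n ≤ 2 * γ := by
      calc (e ^ 3) ^ 2 * (m * s) / n ≤ (e ^ 3) ^ 2 * (γ * (N / e ^ 4) * (2 * σ)) / n := by gcongr
        _ = 2 * γ := by rw [hσ, hnN]; field_simp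
    have h3 : m * δ = 64 * κ ^ 2 * ((e ^ 3) ^ 2 * m ^ 2 / s + (e ^ 3) ^ 2 * (m * s) / n) := by
      rw [hδ]; ring
    calc m * δ ≤ 64 * κ ^ 2 * (γ ^ 2 + 2 * γ) := by rw [h3]; gcongr
      _ = 64 * (κ ^ 2 * γ) * (γ + 2) := by ring
      _ ≤ 1 / 40 := by rw [hκγ]; linarith
  have hK : (1 + δ) ^ m ≤ 21 / 20 := by
    calc (1 + δ) ^ m ≤ Real.exp δ ^ m := by
          gcongr
          linarith [Real.add_one_le_exp δ]
      _ = Real.exp (m * δ) := (Real.exp_nat_mul δ m).symm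
      _ ≤ Real.exp (1 / 40) := Real.exp_le_exp.2 hmδ
      _ ≤ 1 / (1 - 1 / 40) := Real.exp_bound_div_one_sub_of_interval (by norm_num) (by norm_num)
      _ ≤ 21 / 20 := by norm_num
  have hδ1 : (m : ℝ) * d ^ 2 / ((s - m) * (s + d) ^ 2) ≤ δ := by
    calc (m : ℝ) * d ^ 2 / ((s - m) * (s + d) ^ 2)
        ≤ m * (4 * κ * (e ^ 3 * s)) ^ 2 / ((s / 2) * s ^ 2) := by
          gcongr <;> linarith
      _ = 32 * κ ^ 2 * ((e ^ 3) ^ 2 * m / s) := by field_simp; ring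
      _ ≤ 64 * κ ^ 2 * ((e ^ 3) ^ 2 * m / s + (e ^ 3) ^ 2 * s / n) := by
          have : 0 ≤ (e ^ 3) ^ 2 * m / s := by positivity
          have : 0 ≤ (e ^ 3) ^ 2 * s / n := by positivity
          gcongr <;> linarith
  have hδ2 : (d : ℝ) ^ 2 * (1 / (s - m) + 1 / (n - s - m)) ≤ δ * n := by
    calc (d : ℝ) ^ 2 * (1 / (s - m) + 1 / (n - s - m))
        ≤ (4 * κ * (e ^ 3 * s)) ^ 2 * (1 / (s / 2) + 1 / (s / 2)) := by
          refine mul_le_mul (by gcongr) (add_le_add ?_ ?_) ?_ (by positivity)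
          · exact one_div_le_one_div_of_le (by linarith) (by linarith)
          · exact one_div_le_one_div_of_le (by linarith) (by linarith)
          · exact add_nonneg (one_div_nonneg.2 (by linarith)) (one_div_nonneg.2 (by linarith))
      _ = 64 * κ ^ 2 * ((e ^ 3) ^ 2 * s / n) * n := by field_simp; ring
      _ ≤ δ * n := by
          have : 0 ≤ (e ^ 3) ^ 2 * m / s := by positivity
          rw [hδ]
          gcongr
          linarith
  have h2 : 3 * (e ^ 3 * s) ≤ (1 - e ^ 3) * d := by
    have h1 : 0 ≤ 1 - e ^ 3 := by linarith
    calc 3 * (e ^ 3 * s) = 1 * (3 * (e ^ 3 * s)) := by ring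
      _ ≤ κ * (1 - e ^ 3) * (3 * (e ^ 3 * s)) := by gcongr
      _ = (1 - e ^ 3) * (3 * κ * (e ^ 3 * s)) := by ring
      _ ≤ (1 - e ^ 3) * d := by gcongr
  refine ⟨s, d, δ, ?_, ?_, ?_, by linarith, hδ0, hK, hδ1, hδ2⟩
  · exact_mod_cast (by linarith : (m : ℝ) < s)
  · exact_mod_cast (by linarith : (s : ℝ) + m < n)
  · exact_mod_cast (by linarith : (s : ℝ) + d ≤ n)

/-! ### Assembling the lower bound -/

namespace HybridAlgorithm

variable {Ω : Type*} [MeasurableSpace Ω] (A : HybridAlgorithm Ω) {n : ℕ}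

/-- Without samples, totals that differ by a large factor cannot be told apart. -/
theorem exists_one_le_expectedSamples (hn : 1 ≤ n) {ε : ℝ} (hε : ε < 1) {P : Measure Ω}
    [IsProbabilityMeasure P] (hA : ∀ I : SumInstance n, 2 / 3 ≤ A.successProb I P ε) :
    ∃ I : SumInstance n, ENNReal.ofReal (1 / 12) ≤ A.expectedSamples I P := by
  have hcard : (0 : ℝ) < n := by exact_mod_cast hn
  obtain ⟨k, hk⟩ := exists_nat_gt ((1 + ε) / (1 - ε))
  have hpos : ∀ k : ℕ, 0 < ∑ _a : Fin n, ((k : ℝ≥0) + 1) := fun k => by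
    simp only [Finset.sum_const, Finset.card_univ, Fintype.card_fin, nsmul_eq_mul]
    have : (0 : ℝ≥0) < n := by exact_mod_cast hn
    positivity
  let I : ℕ → SumInstance n := fun k => ⟨fun _ => (k : ℝ≥0) + 1, hpos k⟩
  have htot : ∀ k, (I k).total = n * (k + 1) := fun k => by
    simp only [SumInstance.total, I, Finset.sum_const, Finset.card_univ, Fintype.card_fin,
      nsmul_eq_mul]
    push_cast
    rfl
  have hsep : (1 + ε) * (I 0).total < (1 - ε) * (I k).total := by
    rw [htot, htot]
    rw [div_lt_iff₀ (by linarith)] at hk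
    push_cast
    nlinarith
  rcases A.le_expectedSamples_of_secondMomentLE (fun r => A.secondMomentLE_zero (I 0) (I k) r)
    (by norm_num) hsep (hA _) (hA _) with h | h
  · exact ⟨_, by simpa using h⟩
  · exact ⟨_, by simpa using h⟩

/-- The lower bound in terms of the cube roots `N` of `n` and `e` of `ε`. -/
theorem exists_le_expectedSamples {κ N e : ℝ} {m : ℕ} (hκ : 1 ≤ κ) (hN : 0 < N) (he : 0 < e)
    (he1 : e ≤ 1) (hnN : (n : ℝ) = N ^ 3) (hκe : 1 ≤ κ * (1 - e ^ 3)) (hb : 20 * κ ≤ e ^ 2 * N)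
    (hm : m ≤ 1 / (7680 * κ ^ 2) * (N / e ^ 4)) {P : Measure Ω} [IsProbabilityMeasure P]
    (hA : ∀ I : SumInstance n, 2 / 3 ≤ A.successProb I P (e ^ 3)) :
    ∃ I : SumInstance n, ENNReal.ofReal ((m + 1) / 12) ≤ A.expectedSamples I P := by
  obtain ⟨s, d, δ, hms, hmn, hsdn, hsep, hδ0, hK, hδ1, hδ2⟩ :=
    exists_zeroOne_parameters hκ hN he he1 hnN hκe hb hm
  have hs0 : 0 < s := by omega
  have hsn : s ≤ n := by omega
  have hsd0 : 0 < s + d := by omega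
  have hsep' : (1 + e ^ 3) * (SumInstance.zeroOne n s hs0 hsn).total <
      (1 - e ^ 3) * (SumInstance.zeroOne n (s + d) hsd0 hsdn).total := by
    rw [SumInstance.total_zeroOne, SumInstance.total_zeroOne]
    exact_mod_cast hsep
  rcases A.le_expectedSamples_of_secondMomentLE
    (fun r => A.secondMomentLE_zeroOne hs0 hsn hsd0 hsdn hδ0 hms hmn hδ1 hδ2 r le_rfl)
    hK hsep' (hA _) (hA _) with h | h
  · exact ⟨_, h⟩
  · exact ⟨_, h⟩

end HybridAlgorithm

/-- Lower bound for sum estimation in the hybrid setting with `n` known. The constant `c` depends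
only on the bound `ε₀ < 1` on the accuracy; the algorithm may depend on `n` and `ε`, and has to be
correct only on instances with exactly `n` items. -/
theorem mainTheorem8 (ε₀ : ℝ) (hε₀ : ε₀ < 1) :
    ∃ c : ℝ, 0 < c ∧
      ∀ (n : ℕ) (_ : 1 ≤ n) (ε : ℝ) (_ : 0 < ε) (_ : ε ≤ ε₀)
        (Ω : Type*) [MeasurableSpace Ω] (P : Measure Ω) [IsProbabilityMeasure P]
        (A : HybridAlgorithm Ω),
        (∀ I : SumInstance n, 2 / 3 ≤ A.successProb I P ε) →
          ∃ I : SumInstance n,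
            ENNReal.ofReal
                (c * min ((n : ℝ) ^ (1 / 3 : ℝ) / ε ^ (4 / 3 : ℝ)) (n : ℝ)) ≤
              A.expectedSamples I P := by
  -- The accuracy may be relaxed below, but to at most `1 / 2` when it exceeds `ε`; `ε₁` covers both
  -- cases.
  set ε₁ := max ε₀ (1 / 2) with hε₁
  have hε₁1 : ε₁ < 1 := max_lt hε₀ (by norm_num)
  have hε₁2 : 1 / 2 ≤ ε₁ := le_max_right _ _
  set κ := 1 / (1 - ε₁) with hκdef
  have hκ0 : κ * (1 - ε₁) = 1 := by
    have : 1 - ε₁ ≠ 0 := by linarith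
    rw [hκdef]; field_simp
  have hκ : 1 ≤ κ := by
    rw [hκdef, one_le_div (by linarith)]; linarith
  set b := 20 * κ with hb
  have hb1 : 1 ≤ b := by linarith
  set γ := 1 / (7680 * κ ^ 2) with hγ
  have hγ0 : 0 < γ := by positivity
  set c := min (γ / (12 * b ^ 2)) (1 / (12 * (4 * b) ^ 3)) with hc
  have hc0 : 0 < c := by positivity
  refine ⟨c, hc0, fun n hn ε hε hεε₀ Ω _ P _ A hA => ?_⟩
  set N := (n : ℝ) ^ (1 / 3 : ℝ) with hNdef
  have hn0 : (0 : ℝ) < n := by exact_mod_cast hn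
  have hN : 0 < N := by positivity
  have hnN : (n : ℝ) = N ^ 3 := by
    rw [hNdef, ← Real.rpow_natCast, ← Real.rpow_mul hn0.le]; norm_num
  set e₀ := ε ^ (1 / 3 : ℝ) with he₀
  have he₀0 : 0 < e₀ := by positivity
  have hεe : ε = e₀ ^ 3 := by
    rw [he₀, ← Real.rpow_natCast, ← Real.rpow_mul hε.le]; norm_num
  have hεe4 : ε ^ (4 / 3 : ℝ) = e₀ ^ 4 := by
    rw [he₀, ← Real.rpow_natCast, ← Real.rpow_mul hε.le]; norm_num
  rw [hεe4]
  set M := min (N / e₀ ^ 4) (n : ℝ) with hM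
  have hM0 : 0 < M := by positivity
  -- For bounded `n` the claim is a constant, already forced at `m = 0`. Otherwise `N ≥ 4 * b` gives
  -- `q ≤ 1 / 2`.
  rcases lt_or_ge N (4 * b) with hsmall | hlarge
  · obtain ⟨I, hI⟩ := A.exists_one_le_expectedSamples hn (by linarith) hA
    refine ⟨I, le_trans (ENNReal.ofReal_le_ofReal ?_) hI⟩
    calc c * M ≤ 1 / (12 * (4 * b) ^ 3) * (4 * b) ^ 3 := by
          gcongr
          · exact min_le_right _ _
          · exact (min_le_right _ _).trans (hnN.trans_le (by gcongr))
      _ = 1 / 12 := by field_simp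
  -- The least `e` with `b ≤ e ^ 2 * N`. There `N / q ^ 4 = n / b ^ 2`, which yields the linear
  -- regime of the minimum.
  · set q := Real.sqrt (b / N) with hq
    have hq2 : q ^ 2 = b / N := Real.sq_sqrt (by positivity)
    have hq0 : 0 < q := Real.sqrt_pos.2 (by positivity)
    have hq1 : q ≤ 1 / 2 := by
      rw [hq, Real.sqrt_le_left (by norm_num), div_le_iff₀ hN]
      linarith
    set e := max e₀ q with he
    have he0 : 0 < e := lt_max_of_lt_left he₀0
    have hee : e ^ 3 ≤ ε₁ := by
      rcases max_choice e₀ q with h | h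
      · rw [he, h, ← hεe]; exact hεε₀.trans (le_max_left _ _)
      · rw [he, h]
        refine le_trans ?_ hε₁2
        calc q ^ 3 ≤ (1 / 2) ^ 3 := by gcongr
          _ ≤ 1 / 2 := by norm_num
    have he1 : e ≤ 1 := by
      by_contra! h
      have := one_lt_pow₀ h (n := 3) (by norm_num)
      linarith
    have hbe : b ≤ e ^ 2 * N := by
      have : q ^ 2 ≤ e ^ 2 := by gcongr; exact le_max_right _ _
      rw [hq2, div_le_iff₀ hN] at this
      exact this
    have hMe : M ≤ b ^ 2 * (N / e ^ 4) := by
      rcases max_choice e₀ q with h | h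
      · rw [he, h]
        refine (min_le_left _ _).trans ?_
        have : 0 ≤ N / e₀ ^ 4 := by positivity
        nlinarith [one_le_pow₀ hb1 (n := 2)]
      · rw [he, h]
        refine (min_le_right _ _).trans_eq ?_
        have : q ^ 4 = (b / N) ^ 2 := by rw [← hq2]; ring
        rw [this, hnN]
        field_simp
    -- Then `(m + 1) / 12` exceeds `c * M` despite the rounding down.
    set m := ⌊12 * (c * M)⌋₊ with hm
    have hmle : (m : ℝ) ≤ γ * (N / e ^ 4) := by
      calc (m : ℝ) ≤ 12 * (c * M) := Nat.floor_le (by positivity)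
        _ ≤ 12 * (γ / (12 * b ^ 2) * (b ^ 2 * (N / e ^ 4))) := by
            gcongr
            exact min_le_left _ _
        _ = γ * (N / e ^ 4) := by field_simp
    have hA' : ∀ I : SumInstance n, 2 / 3 ≤ A.successProb I P (e ^ 3) := fun I =>
      (hA I).trans (A.successProb_mono I P (by
        rw [hεe]
        gcongr
        exact le_max_left _ _))
    obtain ⟨I, hI⟩ := A.exists_le_expectedSamples hκ hN he0 he1 hnN
      (hκ0.symm.le.trans (by gcongr)) hbe hmle hA'
    refine ⟨I, le_trans (ENNReal.ofReal_le_ofReal ?_) hI⟩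
    linarith [Nat.lt_floor_add_one (12 * (c * M))]
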